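/- Let $k$ be an algebraically closed field and let $X$ be a connected variety over $k$ (varieties are reduced, separated and of finite type over $k$, not necessarily irreducible; "points" are closed points, i.e. $k$-points). Let $\pi:E\to X$ be a vector bundle of rank $n$ on $X$: a variety $E$ with a morphism $\pi:E\to X$ and the structure of an $n$-dimensional $k$-vector space on each fibre $E_x=\pi^{-1}(x)$, such that $X$ is covered by open subsets $U$ for which there is an isomorphism $\pi^{-1}(U)\cong U\times k^n$ over $U$ that is linear on the fibres over points of $U$. Suppose that $F$ satisfies (*) $F$ is a closed subvariety of $E$, and the fibres $F_x=F\cap E_x$ are vector subspaces of the $E_x$ of constant dimension for all points $x\in X$. Call $F$ a sub-bundle of $E$ if it is a closed subvariety of $E$ whose fibres $F_x$ are vector subspaces of the $E_x$ and which, equipped with $\pi|_F:F\to X$ and the induced vector space structures on its fibres, is itself locally trivial, hence a vector bundle. Then $F$ is a sub-bundle of $E$ if and only if for every point $x\in X$ the natural scheme structure on $F_x$, as the scheme-theoretic intersection $F\cap E_x$, or equivalently as the scheme-theoretic fibre $(\pi|_F)^{-1}(x)$, is reduced. (These two scheme structures on $F_x$ coincide.) -/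

import Mathlib

open CategoryTheory CategoryTheory.Limits AlgebraicGeometry

universe u

namespace VarietyBundle

variable {k : Type u} [Field k]

/-- A scheme `X` with structure morphism `s` to `Spec k` is a variety (not necessarily irreducible):
a reduced separated scheme of finite type over `k`. -/
structure IsVariety {X : Scheme.{u}} (s : X ⟶ Spec (.of k)) : Prop where
  isReduced : AlgebraicGeometry.IsReduced X
  isSeparated : IsSeparated s
  locallyOfFiniteType : LocallyOfFiniteType s
  quasiCompact : QuasiCompact s

/-- The points of the variety `X` in the classical sense: the `k`-points. For `k` algebraically
closed these are exactly the closed points of the scheme. -/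
abbrev Point {X : Scheme.{u}} (s : X ⟶ Spec (.of k)) : Type u :=
  {x : Spec (.of k) ⟶ X // x ≫ s = 𝟙 _}

/-- The points of the fibre `π⁻¹(x)`, for `π : E ⟶ X` and a point `x` of `X`. -/
abbrev FibrePoint {X E : Scheme.{u}} {s : X ⟶ Spec (.of k)} (π : E ⟶ X) (x : Point s) : Type u :=
  {e : Spec (.of k) ⟶ E // e ≫ π = x.1}

/-- A point of an open subset `U` of `X`, as a point of `X`. -/
noncomputable def Point.ofOpen {X : Scheme.{u}} {s : X ⟶ Spec (.of k)} {U : X.Opens}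
    (p : Point (U.ι ≫ s)) : Point s :=
  ⟨p.1 ≫ U.ι, (Category.assoc _ _ _).trans p.2⟩

/-- A point of `π⁻¹(U)` over a point `p` of `U`, as a point of the fibre of `π` over `p`. -/
noncomputable def FibrePoint.ofOpen {X E : Scheme.{u}} {s : X ⟶ Spec (.of k)} {π : E ⟶ X}
    {U : X.Opens} (p : Point (U.ι ≫ s)) (e : Spec (.of k) ⟶ (π ⁻¹ᵁ U).toScheme)
    (he : e ≫ π ∣_ U = p.1) : FibrePoint π (Point.ofOpen p) :=
  ⟨e ≫ (π ⁻¹ᵁ U).ι, by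
    rw [Category.assoc, ← morphismRestrict_ι, ← Category.assoc, he]; rfl⟩

/-- A `k`-vector space structure on (the set of points of) each fibre of `π : E ⟶ X`. -/
structure LinearFibres {X E : Scheme.{u}} (s : X ⟶ Spec (.of k)) (π : E ⟶ X) where
  addCommGroup (x : Point s) : AddCommGroup (FibrePoint π x)
  module (x : Point s) : Module k (FibrePoint π x)

/-- The fibre `E_x`, as a vector space. -/
def LinearFibres.Fibre {X E : Scheme.{u}} {s : X ⟶ Spec (.of k)} {π : E ⟶ X}
    (_L : LinearFibres s π) (x : Point s) : Type u :=
  FibrePoint π x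

instance {X E : Scheme.{u}} {s : X ⟶ Spec (.of k)} {π : E ⟶ X}
    (L : LinearFibres s π) (x : Point s) : AddCommGroup (L.Fibre x) :=
  L.addCommGroup x

instance {X E : Scheme.{u}} {s : X ⟶ Spec (.of k)} {π : E ⟶ X}
    (L : LinearFibres s π) (x : Point s) : Module k (L.Fibre x) :=
  L.module x

/-- The product `U × kⁿ`. -/
noncomputable abbrev affineProd (n : ℕ) (U : Scheme.{u}) : Scheme.{u} :=
  AffineSpace (ULift.{u} (Fin n)) U

/-- The projection `U × kⁿ → U`. -/
noncomputable abbrev affineProdFst (n : ℕ) (U : Scheme.{u}) : affineProd n U ⟶ U :=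
  AffineSpace (ULift.{u} (Fin n)) U ↘ U

/-- The vector in `kⁿ` of fibre coordinates of a `k`-point of `U × kⁿ`. -/
noncomputable def fibreCoord {U : Scheme.{u}} {n : ℕ} (p : Spec (.of k) ⟶ affineProd n U) :
    Fin n → k :=
  fun j => (Scheme.ΓSpecIso (.of k)).hom (p.appTop (AffineSpace.coord U ⟨j⟩))

/-- The isomorphism `φ : π⁻¹(U) ≅ U × kⁿ` is a morphism over `U` and induces linear maps
`E_u → kⁿ` on the fibres over the points `u` of `U`. -/
structure IsTrivialization {X E : Scheme.{u}} {s : X ⟶ Spec (.of k)} {π : E ⟶ X}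
    (L : LinearFibres s π) {n : ℕ} (U : X.Opens)
    (φ : (π ⁻¹ᵁ U).toScheme ≅ affineProd n U.toScheme) : Prop where
  comm : φ.hom ≫ affineProdFst n U.toScheme = π ∣_ U
  linear : ∀ u : Point (U.ι ≫ s),
    ∃ l : L.Fibre (Point.ofOpen u) →ₗ[k] (Fin n → k),
      ∀ (e : Spec (.of k) ⟶ (π ⁻¹ᵁ U).toScheme) (he : e ≫ π ∣_ U = u.1),
        l (FibrePoint.ofOpen u e he) = fibreCoord (e ≫ φ.hom)

/-- `π : E ⟶ X`, with the vector space structures `L` on its fibres, is a vector bundle of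
rank `n` on `X`. -/
structure IsVectorBundle {X E : Scheme.{u}} {s : X ⟶ Spec (.of k)} {π : E ⟶ X}
    (L : LinearFibres s π) (n : ℕ) : Prop where
  isVariety : IsVariety (π ≫ s)
  finite : ∀ x : Point s, Module.Finite k (L.Fibre x)
  finrank_eq : ∀ x : Point s, Module.finrank k (L.Fibre x) = n
  locallyTrivial : ∀ x : X, ∃ (U : X.Opens) (_ : x ∈ U)
    (φ : (π ⁻¹ᵁ U).toScheme ≅ affineProd n U.toScheme), IsTrivialization L U φ

/-- `i : F ⟶ E` exhibits `F` as a closed subvariety of the variety `E` (a closed subset with its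
reduced scheme structure). -/
structure IsClosedSubvariety {F E : Scheme.{u}} (i : F ⟶ E) : Prop where
  isClosedImmersion : IsClosedImmersion i
  isReduced : AlgebraicGeometry.IsReduced F

/-- The inclusion of the points of the fibre of `F` over `x` in those of the fibre of `E`. -/
noncomputable def fibreIncl {X E F : Scheme.{u}} {s : X ⟶ Spec (.of k)} (π : E ⟶ X) (i : F ⟶ E) (x : Point s)
    (e : FibrePoint (i ≫ π) x) : FibrePoint π x :=
  ⟨e.1 ≫ i, (Category.assoc _ _ _).trans e.2⟩

theorem fibreIncl_injective {X E F : Scheme.{u}} {s : X ⟶ Spec (.of k)} (π : E ⟶ X) (i : F ⟶ E)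
    [Mono i] (x : Point s) : Function.Injective (fibreIncl π i x) := fun _ _ h =>
  Subtype.ext ((cancel_mono i).1 (congrArg Subtype.val h))

/-- The subset `F_x = F ∩ E_x` of the vector space `E_x`. -/
def LinearFibres.subFibre {X E F : Scheme.{u}} {s : X ⟶ Spec (.of k)} {π : E ⟶ X}
    (L : LinearFibres s π) (i : F ⟶ E) (x : Point s) : Set (L.Fibre x) :=
  Set.range (fibreIncl π i x)

/-- If `F_x` is the vector subspace `W x` of `E_x`, the fibre of `F` over `x` is in bijection
with `W x`. -/
noncomputable def subFibreEquiv {X E F : Scheme.{u}} {s : X ⟶ Spec (.of k)} {π : E ⟶ X}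
    (L : LinearFibres s π) (i : F ⟶ E) [Mono i] (W : ∀ x : Point s, Submodule k (L.Fibre x))
    (hW : ∀ x, (W x : Set (L.Fibre x)) = L.subFibre i x) (x : Point s) :
    FibrePoint (i ≫ π) x ≃ W x :=
  (Equiv.ofInjective (fibreIncl π i x) (fibreIncl_injective π i x)).trans
    (Equiv.setCongr (hW x).symm)

/-- The vector space structures on the fibres of `F` induced from those of `E`, when each `F_x` is
a vector subspace `W x` of `E_x`. -/
noncomputable def LinearFibres.induced {X E F : Scheme.{u}} {s : X ⟶ Spec (.of k)} {π : E ⟶ X}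
    (L : LinearFibres s π) (i : F ⟶ E) [Mono i] (W : ∀ x : Point s, Submodule k (L.Fibre x))
    (hW : ∀ x, (W x : Set (L.Fibre x)) = L.subFibre i x) : LinearFibres s (i ≫ π) where
  addCommGroup x := (subFibreEquiv L i W hW x).addCommGroup
  module x :=
    letI := (subFibreEquiv L i W hW x).addCommGroup
    (subFibreEquiv L i W hW x).module k

/-- `F` is a closed subvariety of `E` and the `F_x` are vector subspaces of the `E_x`, of
constant dimension. -/
def HasConstantRankFibres {X E F : Scheme.{u}} {s : X ⟶ Spec (.of k)} {π : E ⟶ X}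
    (L : LinearFibres s π) (i : F ⟶ E) : Prop :=
  IsClosedSubvariety i ∧ ∃ d : ℕ, ∀ x : Point s, ∃ W : Submodule k (L.Fibre x),
    (W : Set (L.Fibre x)) = L.subFibre i x ∧ Module.finrank k W = d

/-- `F` is a sub-bundle of `E`: a closed subvariety whose fibres `F_x` are vector subspaces of the
`E_x`, and which is a vector bundle with the restriction of `π` and the induced vector space
structures on the fibres. -/
def IsSubbundle {X E F : Scheme.{u}} {s : X ⟶ Spec (.of k)} {π : E ⟶ X}
    (L : LinearFibres s π) (i : F ⟶ E) : Prop :=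
  IsClosedSubvariety i ∧ ∃ (_ : Mono i) (W : ∀ x : Point s, Submodule k (L.Fibre x))
    (hW : ∀ x, (W x : Set (L.Fibre x)) = L.subFibre i x) (m : ℕ),
    IsVectorBundle (L.induced i W hW) m

/-- The scheme-theoretic fibre `π⁻¹(x)` over a point `x`. -/
noncomputable abbrev schemeFibre {X E : Scheme.{u}} {s : X ⟶ Spec (.of k)} (π : E ⟶ X)
    (x : Point s) : Scheme.{u} :=
  pullback π x.1

/-- The scheme-theoretic intersection `F ∩ E_x` in `E`. -/
noncomputable abbrev schemeInter {X E F : Scheme.{u}} {s : X ⟶ Spec (.of k)} (π : E ⟶ X)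
    (i : F ⟶ E) (x : Point s) : Scheme.{u} :=
  pullback i (pullback.fst π x.1 : schemeFibre π x ⟶ E)

end VarietyBundle

namespace VarietyBundle

/-! If `F` is a sub-bundle, its scheme-theoretic fibres are affine spaces over `k`, hence reduced.

For the converse, work over an affine open `Y` of `X` with ring `A`, where `F` is closed in `Y × kⁿ`
and its ring `B` is generated over `A` by the coordinates `b_i`. At a point `y` with maximal ideal
`I`, some `d` coordinates `b_{σ j}` form a basis of the dual of `F_y`, so each `b_i` minus a
combination of them with constant coefficients vanishes at the points of `F_y`. As the scheme `F_y`
is reduced, this difference lies in `IB`, so it is a polynomial in the `b_i` with coefficients in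
`I`. As `F` is reduced and its fibres are stable under scaling, the relations among the `b_i` are
homogeneous; taking linear parts puts the difference in `IM`, where `M` is the `A`-span of the
`b_i`. Nakayama's lemma then makes the `b_{σ j}` generate `M` after inverting one function not
vanishing at `y` (`IsLinearChart.exists_generate`).

There the `b_{σ j}` embed `F` as a closed subscheme of `Y × k^d`. Constancy of the fibre dimension
makes this bijective on points, and the target is reduced, so it is an isomorphism
(`IsLinearChart.isIso_of_generate`). -/

/-! ### Polynomials vanishing on a line, and coordinates on a subspace of `kⁿ`. -/

/-- The values `P_j(v)` are the coefficients of `c ↦ P(cv)`, a one-variable polynomial that vanishes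
on an infinite field. -/
theorem eval_homogeneousComponent_eq_zero {k σ : Type*} [Field k] [Infinite k]
    (P : MvPolynomial σ k) (v : σ → k) (h : ∀ c : k, MvPolynomial.eval (c • v) P = 0) (j : ℕ) :
    MvPolynomial.eval v (MvPolynomial.homogeneousComponent j P) = 0 := by
  classical
  let Q : Polynomial k := ∑ i ∈ Finset.range (P.totalDegree + 1),
    Polynomial.C (MvPolynomial.eval v (MvPolynomial.homogeneousComponent i P)) * Polynomial.X ^ i
  have hQ : Q = 0 := by
    refine Polynomial.funext fun c => ?_
    have hc := h c
    rw [← MvPolynomial.sum_homogeneousComponent P, map_sum] at hc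
    rw [Polynomial.eval_zero, Polynomial.eval_finsetSum, ← hc]
    refine Finset.sum_congr rfl fun i _ => ?_
    rw [Polynomial.eval_mul, Polynomial.eval_C, Polynomial.eval_pow, Polynomial.eval_X]
    have := (MvPolynomial.homogeneousComponent_isHomogeneous i P)
    rw [MvPolynomial.eval_eq, MvPolynomial.eval_eq, Finset.sum_mul]
    refine Finset.sum_congr rfl fun m hm => ?_
    have hm' : m.degree = i := by
      by_contra hne
      exact (MvPolynomial.mem_support_iff.1 hm) (this.coeff_eq_zero hne)
    simp only [Pi.smul_apply, smul_eq_mul, mul_pow, Finset.prod_mul_distrib]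
    rw [Finset.prod_pow_eq_pow_sum, ← Finsupp.degree_apply, hm']
    ring
  by_cases hj : j < P.totalDegree + 1
  · have := congrArg (fun R => Polynomial.coeff R j) hQ
    simpa [Q, Polynomial.finsetSum_coeff, Polynomial.coeff_C_mul, Polynomial.coeff_X_pow,
      hj] using this
  · rw [MvPolynomial.homogeneousComponent_eq_zero _ _ (by omega), map_zero]

/-- The coordinate functionals restricted to `W` span its dual, so a basis of the dual can be chosen
among them. -/
theorem exists_coord_generate {k : Type*} [Field k] {n d : ℕ}
    (W : Submodule k (Fin n → k)) (hW : Module.finrank k W = d) :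
    ∃ (σ : Fin d → Fin n) (c : Fin n → Fin d → k),
      ∀ v ∈ W, ∀ i, v i = ∑ j, c i j * v (σ j) := by
  let f : Fin n → Module.Dual k W := fun i => (LinearMap.proj i).comp W.subtype
  have hspan : Submodule.span k (Set.range f) = ⊤ := by
    refine eq_top_iff.2 fun φ _ => ?_
    obtain ⟨ψ, rfl⟩ := LinearMap.exists_extend φ
    refine (Submodule.mem_span_range_iff_exists_fun k).2 ⟨fun i => ψ (Pi.single i 1), ?_⟩
    ext w
    have := congrArg ψ (pi_eq_sum_univ' (w : Fin n → k))
    simp only [map_sum, map_smul, smul_eq_mul] at this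
    simp only [f, LinearMap.sum_apply, LinearMap.smul_apply, LinearMap.comp_apply,
      Submodule.subtype_apply, LinearMap.proj_apply, smul_eq_mul, this]
    refine Finset.sum_congr rfl fun i _ => ?_
    rw [mul_comm]
  obtain ⟨κ, a, ha, hs, hli⟩ := exists_linearIndependent' k f
  have : Finite κ := Finite.of_injective a ha
  have := Fintype.ofFinite κ
  have hcard : Fintype.card κ = d := by
    rw [← finrank_span_eq_card hli, hs, hspan, finrank_top, Subspace.dual_finrank_eq, hW]
  let e := (Fintype.equivFinOfCardEq hcard).symm
  have hmem : ∀ i, ∃ c : Fin d → k, ∑ j, c j • f (a (e j)) = f i := fun i => by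
    rw [← Submodule.mem_span_range_iff_exists_fun]
    have : Set.range (fun j => f (a (e j))) = Set.range (f ∘ a) := e.surjective.range_comp (f ∘ a)
    rw [this, hs, hspan]
    trivial
  choose c hc using hmem
  refine ⟨a ∘ e, c, fun v hv i => ?_⟩
  have := LinearMap.congr_fun (hc i) ⟨v, hv⟩
  simpa [f] using this.symm

/-! ### Values of functions at `k`-points. -/

variable {k : Type u} [Field k]

/-- The value of global sections at a `k`-point. -/
noncomputable def evalAt {G : Scheme.{u}} (e : Spec (.of k) ⟶ G) : Γ(G, ⊤) →+* k :=
  (e.appTop ≫ (Scheme.ΓSpecIso (.of k)).hom).hom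

theorem evalAt_comp {G Y : Scheme.{u}} (e : Spec (.of k) ⟶ G) (q : G ⟶ Y) (f : Γ(Y, ⊤)) :
    evalAt (e ≫ q) f = evalAt e (q.appTop f) := rfl

/-- The constant global sections of a `k`-scheme. -/
noncomputable def const {Y : Scheme.{u}} (s : Y ⟶ Spec (.of k)) : k →+* Γ(Y, ⊤) :=
  ((Scheme.ΓSpecIso (.of k)).inv ≫ s.appTop).hom

theorem evalAt_const {Y : Scheme.{u}} {s : Y ⟶ Spec (.of k)} (y : Point s) (c : k) :
    evalAt y.1 (const s c) = c := by
  change evalAt y.1 (s.appTop ((Scheme.ΓSpecIso (.of k)).inv c)) = c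
  rw [← evalAt_comp, y.2]
  simp [evalAt]

theorem evalAt_eq_zero_iff {G : Scheme.{u}} (e : Spec (.of k) ⟶ G) (f : Γ(G, ⊤)) :
    evalAt e f = 0 ↔ e.appTop f = 0 := by
  change (Scheme.ΓSpecIso (.of k)).hom (e.appTop f) = 0 ↔ _
  rw [map_eq_zero_iff]
  exact (ConcreteCategory.bijective_of_isIso (Scheme.ΓSpecIso (.of k)).hom).1

/-- Nullstellensatz: on a reduced scheme a nonzero function has a nonempty nonvanishing locus, which
contains a closed point, and closed points are `k`-points. -/
theorem eq_zero_of_evalAt_eq_zero [IsAlgClosed k] {Z : Scheme.{u}} (s : Z ⟶ Spec (.of k))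
    [LocallyOfFiniteType s] [IsReduced Z] (f : Γ(Z, ⊤))
    (h : ∀ e : Point s, evalAt e.1 f = 0) : f = 0 := by
  have : JacobsonSpace Z := LocallyOfFiniteType.jacobsonSpace s
  apply eq_zero_of_basicOpen_eq_bot
  by_contra hne
  obtain ⟨z, hz, hzc : IsClosed {z}⟩ := nonempty_inter_closedPoints
    (TopologicalSpace.Opens.ne_bot_iff_nonempty _ |>.1 hne) (Z.basicOpen f).2.isLocallyClosed
  have h0 := (evalAt_eq_zero_iff _ _).1 (h
    ⟨pointOfClosedPoint s z hzc, pointOfClosedPoint_comp s z hzc⟩)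
  have h1 := Scheme.preimage_basicOpen (pointOfClosedPoint s z hzc) f
  obtain ⟨a⟩ : Nonempty ↥(Spec (.of k)) := inferInstance
  have h2 : a ∈ (pointOfClosedPoint s z hzc) ⁻¹ᵁ (Z.basicOpen f) := by
    change pointOfClosedPoint s z hzc a ∈ Z.basicOpen f
    rw [pointOfClosedPoint_apply]
    exact hz
  have h0' : (pointOfClosedPoint s z hzc).app ⊤ f = 0 := h0
  rw [h1, h0', Scheme.basicOpen_zero] at h2
  exact h2

/-! ### Families of linear subspaces of `kⁿ`. -/

/-- A closed embedding `ρ : G ⟶ Y × kⁿ` over `Y`, such that the fibre of `G` over each point of `Y`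
is a `d`-dimensional linear subspace of `kⁿ`. -/
structure IsLinearChart {Y G : Scheme.{u}} (s : Y ⟶ Spec (.of k)) (q : G ⟶ Y) {n : ℕ}
    (ρ : G ⟶ affineProd n Y) (d : ℕ) : Prop where
  comm : ρ ≫ affineProdFst n Y = q
  isClosedImmersion : IsClosedImmersion ρ
  linear : ∀ y : Point s, ∃ W : Submodule k (Fin n → k), Module.finrank k W = d ∧
    ∀ v, v ∈ W ↔ ∃ e : Spec (.of k) ⟶ G, e ≫ q = y.1 ∧ fibreCoord (e ≫ ρ) = v

theorem fibreCoord_comp {U G : Scheme.{u}} {n : ℕ} (e : Spec (.of k) ⟶ G)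
    (ρ : G ⟶ affineProd n U) :
    fibreCoord (e ≫ ρ) = fun j => evalAt e (ρ.appTop (AffineSpace.coord U ⟨j⟩)) := rfl

/-- Allows the base to be shrunk: the new embedding is the base change of `ρ`, and the fibres over
`k`-points are unchanged. -/
theorem IsLinearChart.pullback {Y G Y' G' : Scheme.{u}} {s : Y ⟶ Spec (.of k)} {q : G ⟶ Y} {n : ℕ}
    {ρ : G ⟶ affineProd n Y} {d : ℕ} (h : IsLinearChart s q ρ d) {j : Y' ⟶ Y} {g : G' ⟶ G}
    {q' : G' ⟶ Y'} (hp : IsPullback g q' q j) :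
    IsLinearChart (j ≫ s) q' (AffineSpace.homOfVector q' fun i : ULift.{u} (Fin n) =>
      (g ≫ ρ).appTop (AffineSpace.coord Y i)) d := by
  set ρ' : G' ⟶ affineProd n Y' := AffineSpace.homOfVector q' fun i : ULift.{u} (Fin n) =>
      (g ≫ ρ).appTop (AffineSpace.coord Y i)
  have hcomm : ρ' ≫ affineProdFst n Y' = q' := AffineSpace.homOfVector_over _ _
  have hsq : g ≫ ρ = ρ' ≫ AffineSpace.map _ j := by
    refine AffineSpace.hom_ext ?_ fun i => ?_
    · rw [Category.assoc, Category.assoc, AffineSpace.map_over, h.comm, hp.w, ← hcomm,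
        Category.assoc]
    · rw [Scheme.Hom.comp_appTop ρ', CommRingCat.comp_apply, AffineSpace.map_appTop_coord,
        AffineSpace.homOfVector_appTop_coord]
  have hpb : IsPullback g ρ' ρ (AffineSpace.map (ULift.{u} (Fin n)) j) := by
    refine IsPullback.of_bot ?_ hsq (AffineSpace.isPullback_map (n := ULift.{u} (Fin n)) j)
    have h1 := h.comm
    dsimp only [affineProdFst] at h1 hcomm
    rw [h1, hcomm]
    exact hp
  have hfc : ∀ e : Spec (.of k) ⟶ G', fibreCoord (e ≫ ρ') = fibreCoord ((e ≫ g) ≫ ρ) := fun e => by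
    rw [Category.assoc, fibreCoord_comp, fibreCoord_comp]
    funext i
    rw [AffineSpace.homOfVector_appTop_coord]
  refine ⟨hcomm, MorphismProperty.of_isPullback (P := @IsClosedImmersion) hpb h.isClosedImmersion,
    fun y => ?_⟩
  obtain ⟨W, hW, hv⟩ := h.linear ⟨y.1 ≫ j, (Category.assoc _ _ _).trans y.2⟩
  refine ⟨W, hW, fun v => (hv v).trans ⟨?_, ?_⟩⟩
  · rintro ⟨e, he, rfl⟩
    refine ⟨hp.lift e y.1 he, hp.lift_snd _ _ _, ?_⟩
    rw [hfc, hp.lift_fst]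
  · rintro ⟨e, he, rfl⟩
    refine ⟨e ≫ g, ?_, (hfc e).symm⟩
    rw [Category.assoc, hp.w]
    exact (Category.assoc _ _ _).symm.trans (congrArg (· ≫ j) he)

theorem exists_eval₂_of_isClosedImmersion {Y G : Scheme.{u}} [IsAffine Y] {q : G ⟶ Y} {n : ℕ}
    (ρ : G ⟶ affineProd n Y) [IsClosedImmersion ρ] (hρ : ρ ≫ affineProdFst n Y = q) (f : Γ(G, ⊤)) :
    ∃ P : MvPolynomial (ULift.{u} (Fin n)) Γ(Y, ⊤),
      MvPolynomial.eval₂ q.appTop.hom (fun i => ρ.appTop (AffineSpace.coord Y i)) P = f := by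
  obtain ⟨a, rfl⟩ := (IsClosedImmersion.isAffine_surjective_of_isAffine ρ).2 f
  have : IsIso (AffineSpace.isoOfIsAffine (ULift.{u} (Fin n)) Y).hom.appTop :=
    inferInstanceAs (IsIso ((AffineSpace.isoOfIsAffine (ULift.{u} (Fin n)) Y).hom.app ⊤))
  have hiso := ConcreteCategory.bijective_of_isIso
    (AffineSpace.isoOfIsAffine (ULift.{u} (Fin n)) Y).hom.appTop
  obtain ⟨P, rfl⟩ := hiso.2 a
  refine ⟨(Scheme.ΓSpecIso _).hom P, ?_⟩
  rw [AffineSpace.isoOfIsAffine_hom_appTop, CommRingCat.comp_apply]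
  subst hρ
  change _ = ρ.appTop (MvPolynomial.eval₂Hom _ _ _)
  rw [Scheme.Hom.comp_appTop]
  change _ = ρ.appTop.hom (MvPolynomial.eval₂Hom _ _ _)
  rw [← RingHom.comp_apply, MvPolynomial.comp_eval₂Hom]
  rfl

theorem evalAt_eval₂ {Y G : Scheme.{u}} {q : G ⟶ Y} {σ : Type*} (b : σ → Γ(G, ⊤))
    (e : Spec (.of k) ⟶ G) (P : MvPolynomial σ Γ(Y, ⊤)) :
    evalAt e (MvPolynomial.eval₂ q.appTop.hom b P) =
      MvPolynomial.eval (fun i => evalAt e (b i)) (MvPolynomial.map (evalAt (e ≫ q)) P) := by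
  rw [MvPolynomial.eval_map, ← MvPolynomial.coe_eval₂Hom, ← RingHom.comp_apply,
    MvPolynomial.comp_eval₂Hom]
  rfl

/-- The ideal of `G` is homogeneous: `G` is reduced, so relations can be tested at `k`-points, and
its fibres are closed under scaling. -/
theorem IsLinearChart.eval₂_homogeneousComponent_eq_zero [IsAlgClosed k] {Y G : Scheme.{u}}
    {s : Y ⟶ Spec (.of k)} [LocallyOfFiniteType s] {q : G ⟶ Y} {n : ℕ} {ρ : G ⟶ affineProd n Y}
    {d : ℕ} (h : IsLinearChart s q ρ d) [AlgebraicGeometry.IsReduced G]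
    (P : MvPolynomial (ULift.{u} (Fin n)) Γ(Y, ⊤))
    (hP : MvPolynomial.eval₂ q.appTop.hom (fun i => ρ.appTop (AffineSpace.coord Y i)) P = 0)
    (j : ℕ) :
    MvPolynomial.eval₂ q.appTop.hom (fun i => ρ.appTop (AffineSpace.coord Y i))
      (MvPolynomial.homogeneousComponent j P) = 0 := by
  have := h.isClosedImmersion
  have hq : LocallyOfFiniteType (q ≫ s) := by
    rw [← h.comm]
    infer_instance
  have : Infinite k := IsAlgClosed.instInfinite
  refine eq_zero_of_evalAt_eq_zero (q ≫ s) _ fun e => ?_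
  rw [evalAt_eval₂]
  have hm : MvPolynomial.map (evalAt (e.1 ≫ q)) (MvPolynomial.homogeneousComponent j P) =
      MvPolynomial.homogeneousComponent j (MvPolynomial.map (evalAt (e.1 ≫ q)) P) := by
    ext m
    rw [MvPolynomial.coeff_map, MvPolynomial.coeff_homogeneousComponent,
      MvPolynomial.coeff_homogeneousComponent, MvPolynomial.coeff_map]
    split_ifs <;> simp
  rw [hm]
  refine eval_homogeneousComponent_eq_zero _ _ (fun c => ?_) j
  obtain ⟨W, -, hv⟩ := h.linear ⟨e.1 ≫ q, (Category.assoc _ _ _).trans e.2⟩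
  -- `e'` is the point `c • e` of the same fibre; `P` vanishes there as well.
  obtain ⟨e', he', hc⟩ := (hv _).1 (W.smul_mem c ((hv _).2 ⟨e.1, rfl, rfl⟩))
  have h0 : evalAt e' (MvPolynomial.eval₂ q.appTop.hom
    (fun i => ρ.appTop (AffineSpace.coord Y i)) P) = 0 := by rw [hP, map_zero]
  rw [evalAt_eval₂] at h0
  dsimp only at he'
  rw [he'] at h0
  rw [← h0]
  congr 2
  funext i
  exact (congrFun hc i.down).symm

/-! ### Reduced fibres and Nakayama's lemma. -/

/-- The ring of the fibre is the pushout `Γ(G) ⊗ k` over `Γ(Y)`. Since `Γ(Y) → k` is onto, `k` maps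
compatibly to `Γ(G)/J`, so the quotient map of `Γ(G)` factors through the ring of the fibre. -/
theorem mem_map_ker_evalAt {Y G : Scheme.{u}} [IsAffine Y] [IsAffine G] {s : Y ⟶ Spec (.of k)}
    (q : G ⟶ Y) (y : Point s) (b : Γ(G, ⊤)) (hb : (pullback.fst q y.1).appTop b = 0) :
    b ∈ Ideal.map q.appTop.hom (RingHom.ker (evalAt y.1)) := by
  set J := Ideal.map q.appTop.hom (RingHom.ker (evalAt y.1)) with hJ
  have hpo := isPushout_appTop_of_isPullback (IsPullback.of_hasPullback q y.1)
  have hle : RingHom.ker (evalAt y.1) ≤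
      RingHom.ker ((Ideal.Quotient.mk J).comp q.appTop.hom) := fun a ha => by
    rw [RingHom.mem_ker, RingHom.comp_apply, Ideal.Quotient.eq_zero_iff_mem]
    exact Ideal.mem_map_of_mem _ ha
  let l : k →+* Γ(G, ⊤) ⧸ J := RingHom.liftOfSurjective (evalAt y.1)
    (fun c => ⟨const s c, evalAt_const y c⟩) ⟨(Ideal.Quotient.mk J).comp q.appTop.hom, hle⟩
  have hl : q.appTop ≫ CommRingCat.ofHom (Ideal.Quotient.mk J) =
      y.1.appTop ≫ (Scheme.ΓSpecIso (.of k)).hom ≫ CommRingCat.ofHom l := by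
    ext a
    exact (RingHom.liftOfSurjective_comp_apply (evalAt y.1)
      (fun c => ⟨const s c, evalAt_const y c⟩)
      ⟨(Ideal.Quotient.mk J).comp q.appTop.hom, hle⟩ a).symm
  have h1 := congrArg (fun φ => φ.hom b) (hpo.inl_desc _ _ hl)
  have h2 : (hpo.desc _ _ hl).hom ((pullback.fst q y.1).appTop b) = Ideal.Quotient.mk J b := h1
  rw [hb, map_zero] at h2
  exact Ideal.Quotient.eq_zero_iff_mem.1 h2.symm

theorem eval₂_homogeneousComponent_one_mem {A B σ : Type*} [CommRing A] [CommRing B] [Algebra A B]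
    (I : Ideal A) (b : σ → B) (P : MvPolynomial σ A) (hP : ∀ m, P.coeff m ∈ I) :
    MvPolynomial.eval₂ (algebraMap A B) b (MvPolynomial.homogeneousComponent 1 P) ∈
      I • Submodule.span A (Set.range b) := by
  rw [MvPolynomial.eval₂_eq]
  refine Submodule.sum_mem _ fun m hm => ?_
  have hdeg : m.degree = 1 := by
    by_contra hne
    exact MvPolynomial.mem_support_iff.1 hm
      ((MvPolynomial.homogeneousComponent_isHomogeneous 1 P).coeff_eq_zero hne)
  obtain ⟨i, rfl⟩ := (Finsupp.sum_eq_one_iff m).1 hdeg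
  rw [← Algebra.smul_def]
  refine Submodule.smul_mem_smul ?_ (Submodule.subset_span ⟨i, ?_⟩)
  · rw [MvPolynomial.coeff_homogeneousComponent]
    split_ifs
    all_goals exact hP _
  · rw [Finsupp.support_single _ one_ne_zero]
    simp

theorem IsLinearChart.exists_generate [IsAlgClosed k] {Y G : Scheme.{u}} [IsAffine Y]
    {s : Y ⟶ Spec (.of k)} [LocallyOfFiniteType s] {q : G ⟶ Y} {n : ℕ} {ρ : G ⟶ affineProd n Y}
    {d : ℕ} (h : IsLinearChart s q ρ d) [AlgebraicGeometry.IsReduced G] (y : Point s)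
    (hy : AlgebraicGeometry.IsReduced (Limits.pullback q y.1)) :
    ∃ (g : Γ(Y, ⊤)) (σ : Fin d → Fin n) (c : Fin n → Fin d → Γ(Y, ⊤)), evalAt y.1 g ≠ 0 ∧
      ∀ i, q.appTop g * ρ.appTop (AffineSpace.coord Y ⟨i⟩) =
        ∑ j, q.appTop (c i j) * ρ.appTop (AffineSpace.coord Y ⟨σ j⟩) := by
  have := h.isClosedImmersion
  have := (IsClosedImmersion.isAffine_surjective_of_isAffine ρ).1
  have : LocallyOfFiniteType q := by
    rw [← h.comm]
    infer_instance
  obtain ⟨W, hW, hv⟩ := h.linear y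
  obtain ⟨σ, c, hc⟩ := exists_coord_generate W hW
  set b : ULift.{u} (Fin n) → Γ(G, ⊤) := fun i => ρ.appTop (AffineSpace.coord Y i) with hb
  let := q.appTop.hom.toAlgebra
  let I : Ideal Γ(Y, ⊤) := RingHom.ker (evalAt y.1)
  let M : Submodule Γ(Y, ⊤) Γ(G, ⊤) := Submodule.span _ (Set.range b)
  let N : Submodule Γ(Y, ⊤) Γ(G, ⊤) := Submodule.span _ (Set.range fun j => b ⟨σ j⟩)
  have key : M ≤ N ⊔ I • M := by
    refine Submodule.span_le.2 ?_
    rintro _ ⟨⟨i⟩, rfl⟩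
    let L : MvPolynomial (ULift.{u} (Fin n)) Γ(Y, ⊤) :=
      ∑ j, MvPolynomial.C (const s (c i j)) * MvPolynomial.X ⟨σ j⟩
    have hL : MvPolynomial.eval₂ q.appTop.hom b L = ∑ j, const s (c i j) • b ⟨σ j⟩ := by
      simp only [L, MvPolynomial.eval₂_sum, MvPolynomial.eval₂_mul, MvPolynomial.eval₂_C,
        MvPolynomial.eval₂_X, Algebra.smul_def]
      rfl
    have hmem : MvPolynomial.eval₂ q.appTop.hom b (MvPolynomial.X ⟨i⟩ - L) ∈
        Ideal.map q.appTop.hom I := by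
      -- Reducedness of the fibre enters here: vanishing at its `k`-points gives vanishing on the
      -- scheme.
      refine mem_map_ker_evalAt q y _ (eq_zero_of_evalAt_eq_zero (pullback.snd q y.1) _ fun e => ?_)
      rw [← evalAt_comp, evalAt_eval₂]
      have hey : (e.1 ≫ pullback.fst q y.1) ≫ q = y.1 := by
        rw [Category.assoc, pullback.condition, ← Category.assoc, e.2, Category.id_comp]
      have := hc _ ((hv _).2 ⟨_, hey, rfl⟩) i
      rw [hey]
      simp only [L, map_sub, map_sum, map_mul, MvPolynomial.map_X, MvPolynomial.map_C,
        MvPolynomial.eval_X, MvPolynomial.eval_C, evalAt_const]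
      exact sub_eq_zero.2 this
    obtain ⟨P, hPI, hP⟩ : ∃ P : MvPolynomial (ULift.{u} (Fin n)) Γ(Y, ⊤),
        (∀ m, P.coeff m ∈ I) ∧ MvPolynomial.eval₂ q.appTop.hom b P =
          MvPolynomial.eval₂ q.appTop.hom b (MvPolynomial.X ⟨i⟩ - L) := by
      rw [← MvPolynomial.eval₂Hom_comp_C q.appTop.hom b, ← Ideal.map_map,
        Ideal.mem_map_iff_of_surjective _
          (fun f => exists_eval₂_of_isClosedImmersion ρ h.comm f)] at hmem
      obtain ⟨P, hP, hP'⟩ := hmem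
      refine ⟨P, MvPolynomial.mem_map_C_iff.1 hP, hP'.trans ?_⟩
      simp
    -- `X_i - L` is already linear, so the degree-one part of this relation replaces `P` by its
    -- linear part alone.
    have hz := h.eval₂_homogeneousComponent_eq_zero (MvPolynomial.X ⟨i⟩ - L - P)
      (by
        change MvPolynomial.eval₂ q.appTop.hom b _ = 0
        rw [MvPolynomial.eval₂_sub, hP, sub_self]) 1
    have hXL : MvPolynomial.homogeneousComponent 1 (MvPolynomial.X ⟨i⟩ - L) =
        MvPolynomial.X ⟨i⟩ - L := by
      refine (MvPolynomial.homogeneousComponent_of_mem (n := 1) (m := 1) ?_).trans (if_pos rfl)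
      refine (MvPolynomial.isHomogeneous_X _ _).sub (MvPolynomial.IsHomogeneous.sum _ _ _ fun j _ => ?_)
      simpa using (MvPolynomial.isHomogeneous_C _ _).mul (MvPolynomial.isHomogeneous_X _ _)
    change MvPolynomial.eval₂ q.appTop.hom b _ = 0 at hz
    rw [map_sub, hXL, MvPolynomial.eval₂_sub, MvPolynomial.eval₂_sub, MvPolynomial.eval₂_X, hL,
      sub_sub, sub_eq_zero] at hz
    rw [SetLike.mem_coe, hz]
    refine Submodule.add_mem_sup (Submodule.sum_mem _ fun j _ => N.smul_mem _
      (Submodule.subset_span ⟨j, rfl⟩)) ?_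
    exact eval₂_homogeneousComponent_one_mem I b P hPI
  -- Nakayama without localizing: `r` is `1` modulo `I`, hence nonzero at `y`.
  obtain ⟨r, hr, hrM⟩ := Submodule.exists_sub_one_mem_and_smul_le_of_fg_of_le_sup
    (Submodule.fg_span (Set.finite_range b)) le_rfl key
  have hmem : ∀ i, ∃ c : Fin d → Γ(Y, ⊤), ∑ j, c j • b ⟨σ j⟩ = r • b ⟨i⟩ := fun i => by
    rw [← Submodule.mem_span_range_iff_exists_fun]
    exact hrM (Submodule.smul_mem_pointwise_smul _ _ _ (Submodule.subset_span ⟨_, rfl⟩))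
  choose c' hc' using hmem
  refine ⟨r, σ, c', ?_, fun i => ?_⟩
  · have : evalAt y.1 r - 1 = 0 := by
      have := hr
      rwa [RingHom.mem_ker, map_sub, map_one] at this
    rw [sub_eq_zero.1 this]
    exact one_ne_zero
  · have := (hc' i).symm
    simp only [Algebra.smul_def] at this
    exact this

/-! ### Trivialization by `d` generating coordinates. -/

/-- Generation makes the map to `Y × k^d` a closed immersion. Its closed range contains all closed
points, which are dense, so it is surjective; a surjective closed immersion into a reduced scheme is
an isomorphism. -/
theorem IsLinearChart.isIso_of_generate [IsAlgClosed k] {Y G : Scheme.{u}} [IsAffine Y]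
    {s : Y ⟶ Spec (.of k)} [LocallyOfFiniteType s] [AlgebraicGeometry.IsReduced Y] {q : G ⟶ Y}
    {n : ℕ} {ρ : G ⟶ affineProd n Y} {d : ℕ} (h : IsLinearChart s q ρ d)
    (σ : Fin d → Fin n) (c : Fin n → Fin d → Γ(Y, ⊤))
    (hc : ∀ i, ρ.appTop (AffineSpace.coord Y ⟨i⟩) =
        ∑ j, q.appTop (c i j) * ρ.appTop (AffineSpace.coord Y ⟨σ j⟩)) :
    IsIso (AffineSpace.homOfVector q fun j : ULift.{u} (Fin d) =>
      ρ.appTop (AffineSpace.coord Y ⟨σ j.down⟩)) := by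
  have := h.isClosedImmersion
  have := (IsClosedImmersion.isAffine_surjective_of_isAffine ρ).1
  set ψ : G ⟶ affineProd d Y := AffineSpace.homOfVector q fun j : ULift.{u} (Fin d) =>
      ρ.appTop (AffineSpace.coord Y ⟨σ j.down⟩)
  have hψq : ψ ≫ affineProdFst d Y = q := AffineSpace.homOfVector_over _ _
  have hψc : ∀ j, ψ.appTop (AffineSpace.coord Y ⟨j⟩) = ρ.appTop (AffineSpace.coord Y ⟨σ j⟩) :=
    fun j => AffineSpace.homOfVector_appTop_coord _ _ _
  have hsurj : Function.Surjective ψ.appTop := fun f => by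
    obtain ⟨P, rfl⟩ := exists_eval₂_of_isClosedImmersion ρ h.comm f
    change _ ∈ ψ.appTop.hom.range
    have hq : ∀ a, q.appTop.hom a ∈ ψ.appTop.hom.range := fun a => by
      rw [← hψq]
      exact ⟨_, rfl⟩
    rw [MvPolynomial.eval₂_eq]
    refine Subring.sum_mem _ fun m _ => Subring.mul_mem _ (hq _)
      (Subring.prod_mem _ fun i _ => Subring.pow_mem _ ?_ _)
    have hi := hc i.down
    change ρ.appTop (AffineSpace.coord Y ⟨i.down⟩) ∈ _
    rw [hi]
    exact Subring.sum_mem _ fun j _ => Subring.mul_mem _ (hq _) ⟨_, hψc j⟩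
  have hcl : IsClosedImmersion ψ := IsClosedImmersion.of_surjective_of_isAffine ψ hsurj
  have hpts : ∀ p : Point (affineProdFst d Y ≫ s), ∃ e, e ≫ ψ = p.1 := fun p => by
    let y : Point s := ⟨p.1 ≫ affineProdFst d Y, (Category.assoc _ _ _).trans p.2⟩
    obtain ⟨W, hW, hv⟩ := h.linear y
    let T : W →ₗ[k] (Fin d → k) := (LinearMap.funLeft k k σ).comp W.subtype
    have hinj : Function.Injective T := by
      refine (injective_iff_map_eq_zero T).2 fun w hw => ?_
      obtain ⟨e, he, hew⟩ := (hv _).1 w.2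
      ext i
      have hi := congrArg (evalAt e) (hc i)
      simp only [map_sum, map_mul] at hi
      have hwσ : ∀ j, evalAt e (ρ.appTop (AffineSpace.coord Y ⟨σ j⟩)) = 0 := fun j => by
        have h1 := congrFun hew (σ j)
        have h2 := congrFun hw j
        exact h1.trans h2
      simp only [hwσ, mul_zero, Finset.sum_const_zero] at hi
      exact (congrFun hew i).symm.trans hi
    -- The fibre dimension is `d` over every point, not only at the one where the coordinates were
    -- chosen.
    have hsurjT : Function.Surjective T :=
      (LinearMap.injective_iff_surjective_of_finrank_eq_finrank (by simp [hW])).1 hinj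
    obtain ⟨w, hw⟩ := hsurjT (fibreCoord p.1)
    obtain ⟨e, he, hew⟩ := (hv _).1 w.2
    refine ⟨e, AffineSpace.hom_ext ?_ fun j => ?_⟩
    · rw [Category.assoc]
      exact (congrArg (e ≫ ·) hψq).trans he
    · have h1 : evalAt (e ≫ ψ) (AffineSpace.coord Y j) = evalAt p.1 (AffineSpace.coord Y j) := by
        have h2 : evalAt (e ≫ ψ) (AffineSpace.coord Y j) = fibreCoord (e ≫ ρ) (σ j.down) :=
          congrArg (evalAt e) (hψc j.down)
        rw [h2, hew]
        exact congrFun hw j.down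
      exact (ConcreteCategory.bijective_of_isIso (Scheme.ΓSpecIso (.of k)).hom).1 h1
  have : Surjective ψ := by
    have : JacobsonSpace ↥(affineProd d Y) :=
      LocallyOfFiniteType.jacobsonSpace (affineProdFst d Y ≫ s)
    refine ⟨Set.range_eq_univ.1 (Set.univ_subset_iff.1 ?_)⟩
    rw [← closure_closedPoints]
    refine closure_minimal (fun x (hx : IsClosed {x}) => ?_) ψ.isClosedEmbedding.isClosed_range
    obtain ⟨e, he⟩ := hpts ⟨pointOfClosedPoint (affineProdFst d Y ≫ s) x hx,
      pointOfClosedPoint_comp _ _ _⟩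
    obtain ⟨a⟩ : Nonempty ↥(Spec (.of k)) := inferInstance
    refine ⟨e a, ?_⟩
    rw [← Scheme.Hom.comp_apply, he]
    exact pointOfClosedPoint_apply _ _ _ a
  exact isIso_of_isClosedImmersion_of_surjective ψ

/-! ### From bundles and trivializations to linear charts. -/

theorem isUnit_of_basicOpen_eq_top {Z : Scheme.{u}} (f : Γ(Z, ⊤)) (h : Z.basicOpen f = ⊤) :
    IsUnit f :=
  RingedSpace.isUnit_of_isUnit_germ Z.toRingedSpace ⊤ f fun x _ =>
    (Z.mem_basicOpen_top f x).1 (by rw [h]; exact TopologicalSpace.Opens.mem_top x)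

/-- A point of `X` whose image lies in the open subset `U` factors through `U`. -/
theorem exists_comp_ι_eq {X : Scheme.{u}} (x : Spec (.of k) ⟶ X) {U : X.Opens}
    (a : ↥(Spec (.of k))) (h : x a ∈ U) : ∃ u : Spec (.of k) ⟶ U.toScheme, u ≫ U.ι = x := by
  refine ⟨IsOpenImmersion.lift U.ι x ?_, IsOpenImmersion.lift_fac _ _ _⟩
  rintro _ ⟨b, rfl⟩
  rw [Scheme.Opens.range_ι]
  have : Subsingleton ↥(Spec (.of k)) := inferInstanceAs (Subsingleton (PrimeSpectrum k))
  rw [Subsingleton.elim b a]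
  exact h

/-- A trivialization around `x` identifies the fibre with affine space over `k`. -/
theorem IsVectorBundle.isReduced_schemeFibre {X F : Scheme.{u}} {s : X ⟶ Spec (.of k)} {p : F ⟶ X}
    {L : LinearFibres s p} {m : ℕ} (h : IsVectorBundle L m) (x : Point s) :
    AlgebraicGeometry.IsReduced (schemeFibre p x) := by
  obtain ⟨a⟩ : Nonempty ↥(Spec (.of k)) := inferInstance
  obtain ⟨U, hU, φ, hφ⟩ := h.locallyTrivial (x.1 a)
  obtain ⟨u, hu⟩ := exists_comp_ι_eq x.1 a hU
  have h1 : IsPullback (AffineSpace.map (ULift.{u} (Fin m)) u ≫ φ.inv)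
      (affineProdFst m (Spec (.of k))) (p ∣_ U) u :=
    (AffineSpace.isPullback_map (n := ULift.{u} (Fin m)) u).of_iso (Iso.refl _) φ.symm
      (Iso.refl _) (Iso.refl _) (by simp) (by simp) (by
        rw [Iso.refl_hom, Category.comp_id, Iso.symm_hom, Iso.eq_inv_comp]
        exact hφ.comm) (by simp)
  have h2 := h1.paste_horiz (isPullback_morphismRestrict p U).flip
  rw [hu] at h2
  have : AlgebraicGeometry.IsReduced (affineProd m (Spec (.of k))) := inferInstance
  exact isReduced_of_isOpenImmersion (h2.isoPullback.inv)

theorem IsTrivialization.exists_linear {X E : Scheme.{u}} {s : X ⟶ Spec (.of k)} {π : E ⟶ X}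
    {L : LinearFibres s π} {n : ℕ} {U : X.Opens} {φ : (π ⁻¹ᵁ U).toScheme ≅ affineProd n U.toScheme}
    (h : IsTrivialization L U φ) (x : Point s) (u : Spec (.of k) ⟶ U.toScheme)
    (hu : u ≫ U.ι = x.1) :
    ∃ l : L.Fibre x →ₗ[k] (Fin n → k), ∀ (e : Spec (.of k) ⟶ (π ⁻¹ᵁ U).toScheme)
      (he : (e ≫ (π ⁻¹ᵁ U).ι) ≫ π = x.1), l ⟨e ≫ (π ⁻¹ᵁ U).ι, he⟩ = fibreCoord (e ≫ φ.hom) := by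
  obtain ⟨x, hx⟩ := x
  dsimp only at hu
  subst hu
  obtain ⟨l, hl⟩ := h.linear ⟨u, (Category.assoc _ _ _).symm.trans hx⟩
  refine ⟨l, fun e he => hl e ?_⟩
  rw [← cancel_mono U.ι, Category.assoc, morphismRestrict_ι, ← Category.assoc]
  exact he

theorem exists_fibrePoint_lift {X E : Scheme.{u}} {s : X ⟶ Spec (.of k)} {π : E ⟶ X}
    {U : X.Opens} (x : Point s) (u : Spec (.of k) ⟶ U.toScheme)
    (hu : u ≫ U.ι = x.1) (e : FibrePoint π x) :
    ∃ e' : Spec (.of k) ⟶ (π ⁻¹ᵁ U).toScheme, e' ≫ (π ⁻¹ᵁ U).ι = e.1 ∧ e' ≫ π ∣_ U = u :=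
  ⟨(isPullback_morphismRestrict π U).lift u e.1 (hu.trans e.2.symm),
    (isPullback_morphismRestrict π U).lift_snd _ _ _,
    (isPullback_morphismRestrict π U).lift_fst _ _ _⟩

theorem eq_of_fibreCoord_eq {U : Scheme.{u}} {n : ℕ} {p p' : Spec (.of k) ⟶ affineProd n U}
    (h : p ≫ affineProdFst n U = p' ≫ affineProdFst n U) (hc : fibreCoord p = fibreCoord p') :
    p = p' :=
  AffineSpace.hom_ext h fun j =>
    (ConcreteCategory.bijective_of_isIso (Scheme.ΓSpecIso (.of k)).hom).1 (congrFun hc j.down)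

/-- The restriction of `i : F ⟶ E` to the parts over the open subset `U` of `X`. -/
noncomputable def restrictIncl {X E F : Scheme.{u}} (π : E ⟶ X) (i : F ⟶ E) (U : X.Opens) :
    ((i ≫ π) ⁻¹ᵁ U).toScheme ⟶ (π ⁻¹ᵁ U).toScheme :=
  i ∣_ (π ⁻¹ᵁ U)

instance {X E F : Scheme.{u}} (π : E ⟶ X) (i : F ⟶ E) [IsClosedImmersion i] (U : X.Opens) :
    IsClosedImmersion (restrictIncl π i U) :=
  inferInstanceAs (IsClosedImmersion (i ∣_ (π ⁻¹ᵁ U)))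

theorem restrictIncl_ι {X E F : Scheme.{u}} (π : E ⟶ X) (i : F ⟶ E) (U : X.Opens) :
    restrictIncl π i U ≫ (π ⁻¹ᵁ U).ι = ((i ≫ π) ⁻¹ᵁ U).ι ≫ i :=
  morphismRestrict_ι i (π ⁻¹ᵁ U)

theorem restrictIncl_comp {X E F : Scheme.{u}} (π : E ⟶ X) (i : F ⟶ E) (U : X.Opens) :
    restrictIncl π i U ≫ π ∣_ U = (i ≫ π) ∣_ U :=
  (morphismRestrict_comp i π U).symm

theorem IsTrivialization.isLinearChart {X E F : Scheme.{u}} {s : X ⟶ Spec (.of k)} {π : E ⟶ X}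
    {L : LinearFibres s π} {n : ℕ} {U : X.Opens} {φ : (π ⁻¹ᵁ U).toScheme ≅ affineProd n U.toScheme}
    (h : IsTrivialization L U φ) (i : F ⟶ E) [IsClosedImmersion i]
    (W : ∀ x : Point s, Submodule k (L.Fibre x))
    (hW : ∀ x, (W x : Set (L.Fibre x)) = L.subFibre i x) (d : ℕ)
    (hd : ∀ x, Module.finrank k (W x) = d) :
    IsLinearChart (U.ι ≫ s) ((i ≫ π) ∣_ U) (restrictIncl π i U ≫ φ.hom) d := by
  have hcomm : (restrictIncl π i U ≫ φ.hom) ≫ affineProdFst n U.toScheme = (i ≫ π) ∣_ U := by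
    rw [Category.assoc, h.comm, restrictIncl_comp]
  refine ⟨hcomm, inferInstance, fun y => ?_⟩
  let x := Point.ofOpen y
  obtain ⟨l, hl⟩ := h.exists_linear x y.1 rfl
  -- A point of `U × kⁿ` is determined by its base point and its coordinates, and `φ` is an
  -- isomorphism.
  have hinj : Function.Injective l := fun e₁ e₂ he => by
    obtain ⟨e₁', h₁, h₁'⟩ := exists_fibrePoint_lift x y.1 rfl e₁
    obtain ⟨e₂', h₂, h₂'⟩ := exists_fibrePoint_lift x y.1 rfl e₂
    obtain ⟨e₁, he₁⟩ := e₁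
    obtain ⟨e₂, he₂⟩ := e₂
    dsimp only at h₁ h₂
    subst h₁ h₂
    have hc := ((hl _ he₁).symm.trans he).trans (hl _ he₂)
    have := eq_of_fibreCoord_eq (by
      rw [Category.assoc, Category.assoc, h.comm, h₁', h₂']) hc
    rw [cancel_mono] at this
    subst this
    rfl
  refine ⟨(W x).map l, (Submodule.equivMapOfInjective l hinj (W x)).finrank_eq.symm.trans (hd x),
    fun v => ⟨?_, ?_⟩⟩
  · rintro ⟨w, hw, rfl⟩
    rw [hW] at hw
    obtain ⟨e, rfl⟩ := hw
    obtain ⟨e', h₁, h₂⟩ := exists_fibrePoint_lift x y.1 rfl e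
    obtain ⟨e, he⟩ := e
    dsimp only at h₁
    subst h₁
    refine ⟨e', h₂, ?_⟩
    have h3 : (e' ≫ restrictIncl π i U) ≫ (π ⁻¹ᵁ U).ι = (e' ≫ ((i ≫ π) ⁻¹ᵁ U).ι) ≫ i := by
      rw [Category.assoc, restrictIncl_ι, Category.assoc]
    have h4 := hl (e' ≫ restrictIncl π i U) (by rw [h3, Category.assoc]; exact he)
    rw [← Category.assoc, ← h4]
    congr 1
    exact Subtype.ext h3
  · rintro ⟨e, he, rfl⟩
    have h3 : (e ≫ restrictIncl π i U) ≫ (π ⁻¹ᵁ U).ι = (e ≫ ((i ≫ π) ⁻¹ᵁ U).ι) ≫ i := by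
      rw [Category.assoc, restrictIncl_ι, Category.assoc]
    have h5 : (e ≫ ((i ≫ π) ⁻¹ᵁ U).ι) ≫ i ≫ π = x.1 := by
      rw [Category.assoc, ← morphismRestrict_ι, ← Category.assoc, he]
      rfl
    have h4 := hl (e ≫ restrictIncl π i U) (by rw [h3, Category.assoc]; exact h5)
    refine ⟨_, ?_, h4.trans (by rw [Category.assoc])⟩
    rw [hW]
    exact ⟨⟨_, h5⟩, Subtype.ext h3.symm⟩

theorem isPullback_homOfLE {X F : Scheme.{u}} (p : F ⟶ X) {U V : X.Opens} (h : V ≤ U) :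
    IsPullback (F.homOfLE (p.preimage_mono h)) (p ∣_ V) (p ∣_ U) (X.homOfLE h) := by
  refine IsPullback.of_right (h₁₂ := (p ⁻¹ᵁ U).ι) (h₂₂ := U.ι) (v₁₃ := p) ?_ ?_
    (isPullback_morphismRestrict p U).flip
  · rw [Scheme.homOfLE_ι, Scheme.homOfLE_ι]
    exact (isPullback_morphismRestrict p V).flip
  · rw [← cancel_mono U.ι, Category.assoc, Category.assoc, morphismRestrict_ι, Scheme.homOfLE_ι,
      Scheme.homOfLE_ι_assoc, morphismRestrict_ι]

/-- The linear equivalence between a fibre of `F` and the corresponding vector subspace. -/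
noncomputable def inducedFibreEquiv {X E F : Scheme.{u}} {s : X ⟶ Spec (.of k)} {π : E ⟶ X}
    (L : LinearFibres s π) (i : F ⟶ E) [Mono i] (W : ∀ x : Point s, Submodule k (L.Fibre x))
    (hW : ∀ x, (W x : Set (L.Fibre x)) = L.subFibre i x) (x : Point s) :
    (L.induced i W hW).Fibre x ≃ₗ[k] W x :=
  (subFibreEquiv L i W hW x).linearEquiv k

theorem generate_of_isUnit {Y G Y' G' : Scheme.{u}} {q : G ⟶ Y} {j : Y' ⟶ Y} {h : G' ⟶ G}
    {q' : G' ⟶ Y'} (hsq : h ≫ q = q' ≫ j) {g : Γ(Y, ⊤)} (hg : IsUnit (j.appTop g)) {n d : ℕ}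
    {b : Fin n → Γ(G, ⊤)} {σ : Fin d → Fin n} {c : Fin n → Fin d → Γ(Y, ⊤)}
    (hc : ∀ i, q.appTop g * b i = ∑ l, q.appTop (c i l) * b (σ l)) :
    ∃ c' : Fin n → Fin d → Γ(Y', ⊤), ∀ i,
      h.appTop (b i) = ∑ l, q'.appTop (c' i l) * h.appTop (b (σ l)) := by
  have hqq : ∀ f, h.appTop (q.appTop f) = q'.appTop (j.appTop f) := fun f =>
    congrArg (fun φ : G' ⟶ Y => φ.appTop f) hsq
  obtain ⟨t, ht⟩ := hg.exists_left_inv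
  refine ⟨fun i l => t * j.appTop (c i l), fun i => ?_⟩
  have h1 := congrArg h.appTop (hc i)
  simp only [map_mul, map_sum, hqq] at h1
  simp only [map_mul, mul_assoc]
  rw [← Finset.mul_sum, ← h1, ← mul_assoc, ← map_mul, ht, map_one, one_mul]

theorem mem_basicOpen_of_evalAt_ne_zero {Y : Scheme.{u}} (y : Spec (.of k) ⟶ Y) (g : Γ(Y, ⊤))
    (h : evalAt y g ≠ 0) (a : ↥(Spec (.of k))) : y a ∈ Y.basicOpen g := by
  have hu : IsUnit (y.appTop g) := by
    have h1 := h.isUnit.map (Scheme.ΓSpecIso (.of k)).inv.hom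
    have h2 : (Scheme.ΓSpecIso (.of k)).inv.hom (evalAt y g) = y.appTop g :=
      congrArg (fun φ => φ.hom (y.appTop g)) (Scheme.ΓSpecIso (.of k)).hom_inv_id
    rwa [h2] at h1
  have h3 : y ⁻¹ᵁ Y.basicOpen g = ⊤ := by
    rw [Scheme.preimage_basicOpen_top]
    exact Scheme.basicOpen_of_isUnit _ hu
  change a ∈ y ⁻¹ᵁ Y.basicOpen g
  rw [h3]
  exact TopologicalSpace.Opens.mem_top a

theorem isUnit_homOfLE_appTop {X : Scheme.{u}} {V V' : X.Opens} (h : V' ≤ V)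
    (g : Γ(V.toScheme, ⊤)) (hg : V' ≤ V.ι ''ᵁ V.toScheme.basicOpen g) :
    IsUnit ((X.homOfLE h).appTop g) := by
  apply isUnit_of_basicOpen_eq_top
  rw [← Scheme.preimage_basicOpen_top]
  refine top_le_iff.1 fun x _ => ?_
  obtain ⟨b, hb, hbx⟩ := hg x.2
  have : b = X.homOfLE h x := by
    apply V.ι.isOpenEmbedding.injective
    rw [← Scheme.Hom.comp_apply, Scheme.homOfLE_ι]
    exact hbx
  change X.homOfLE h x ∈ V.toScheme.basicOpen g
  rw [← this]
  exact hb

/-! ### Local triviality of `F` and the theorem. -/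

theorem IsTrivialization.exists_induced [IsAlgClosed k] {X E F : Scheme.{u}}
    {s : X ⟶ Spec (.of k)} [LocallyOfFiniteType s] [AlgebraicGeometry.IsReduced X] {π : E ⟶ X}
    {L : LinearFibres s π} {n : ℕ} {U : X.Opens} {φ : (π ⁻¹ᵁ U).toScheme ≅ affineProd n U.toScheme}
    (h : IsTrivialization L U φ) (i : F ⟶ E) [Mono i] [IsClosedImmersion i]
    [AlgebraicGeometry.IsReduced F] (W : ∀ x : Point s, Submodule k (L.Fibre x))
    (hW : ∀ x, (W x : Set (L.Fibre x)) = L.subFibre i x) (d : ℕ)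
    (hd : ∀ x, Module.finrank k (W x) = d) (x : Point s) (a : ↥(Spec (.of k))) (hx : x.1 a ∈ U)
    (hred : AlgebraicGeometry.IsReduced (schemeFibre (i ≫ π) x)) :
    ∃ (V : X.Opens) (_ : x.1 a ∈ V)
      (ψ : ((i ≫ π) ⁻¹ᵁ V).toScheme ≅ affineProd d V.toScheme),
      IsTrivialization (L.induced i W hW) V ψ := by
  obtain ⟨V, hV, hxV, hVU⟩ := exists_isAffineOpen_mem_and_subset hx
  replace hVU : V ≤ U := hVU
  have : IsAffine V.toScheme := hV
  have chartU := h.isLinearChart i W hW d hd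
  have chartV := chartU.pullback (isPullback_homOfLE (i ≫ π) hVU)
  obtain ⟨v, hv⟩ := exists_comp_ι_eq x.1 a hxV
  let y : Point (X.homOfLE hVU ≫ U.ι ≫ s) := ⟨v, by
    rw [Scheme.homOfLE_ι_assoc, ← Category.assoc, hv, x.2]⟩
  have hfib : AlgebraicGeometry.IsReduced (pullback ((i ≫ π) ∣_ V) y.1) := by
    have h2 := (IsPullback.of_hasPullback ((i ≫ π) ∣_ V) v).paste_horiz
      (isPullback_morphismRestrict (i ≫ π) V).flip
    rw [hv] at h2
    exact isReduced_of_isOpenImmersion h2.isoPullback.hom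
  obtain ⟨g, σ, c, hg, hc⟩ := chartV.exists_generate y hfib
  -- On `V'` the function `g` is invertible, so the relations in `hc` can be divided by it.
  let V' : X.Opens := V.ι ''ᵁ V.toScheme.basicOpen g
  have hV'V : V' ≤ V := V.ι_image_le _
  have : IsAffine V'.toScheme :=
    (((isAffineOpen_top V.toScheme).basicOpen g).image_of_isOpenImmersion V.ι)
  have hxV' : x.1 a ∈ V' := ⟨v a, mem_basicOpen_of_evalAt_ne_zero v g hg a, by
    rw [← hv]; rfl⟩
  have hsq := isPullback_homOfLE (i ≫ π) hV'V
  have chartV' := chartV.pullback hsq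
  obtain ⟨c', hc'⟩ := generate_of_isUnit hsq.w
    (isUnit_homOfLE_appTop hV'V g le_rfl) hc
  have hiso := chartV'.isIso_of_generate σ c' fun l => by
    simp only [AffineSpace.homOfVector_appTop_coord, Scheme.Hom.comp_appTop,
      CommRingCat.comp_apply] at hc' ⊢
    exact hc' l
  refine ⟨V', hxV', @asIso _ _ _ _ _ hiso, AffineSpace.homOfVector_over _ _, fun u => ?_⟩
  obtain ⟨l, hl⟩ := h.exists_linear (Point.ofOpen u) (u.1 ≫ X.homOfLE (hV'V.trans hVU)) (by
    rw [Category.assoc, Scheme.homOfLE_ι]; rfl)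
  -- On fibres the trivialization of `F` is that of `E` followed by projection to the coordinates in
  -- `σ`, hence linear.
  refine ⟨(LinearMap.funLeft k k σ).comp (l.comp ((W _).subtype.comp
    (inducedFibreEquiv L i W hW _).toLinearMap)), fun e he => ?_⟩
  let e' := e ≫ F.homOfLE ((i ≫ π).preimage_mono hV'V) ≫ F.homOfLE ((i ≫ π).preimage_mono hVU)
  have he' : (e' ≫ restrictIncl π i U) ≫ (π ⁻¹ᵁ U).ι = (e ≫ ((i ≫ π) ⁻¹ᵁ V').ι) ≫ i := by
    simp only [e', Category.assoc, restrictIncl_ι, Scheme.homOfLE_ι_assoc]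
  have he'' : ((e ≫ ((i ≫ π) ⁻¹ᵁ V').ι) ≫ i) ≫ π = (Point.ofOpen u).1 :=
    (Category.assoc _ _ _).trans (FibrePoint.ofOpen u e he).2
  have h1 : l (fibreIncl π i _ (FibrePoint.ofOpen u e he)) =
      fibreCoord ((e' ≫ restrictIncl π i U) ≫ φ.hom) := by
    rw [← hl _ (by rw [he']; exact he'')]
    congr 1
    exact Subtype.ext he'.symm
  funext j
  refine (congrFun h1 (σ j)).trans ?_
  rw [asIso_hom, fibreCoord_comp e]
  simp only [AffineSpace.homOfVector_appTop_coord, Scheme.Hom.comp_appTop, CommRingCat.comp_apply]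
  rfl

theorem isSubbundle_of_isReduced_schemeFibre [IsAlgClosed k] {X E F : Scheme.{u}}
    {s : X ⟶ Spec (.of k)} (hX : IsVariety s) {π : E ⟶ X} {L : LinearFibres s π} {n : ℕ}
    (hE : IsVectorBundle L n) {i : F ⟶ E} (hF : HasConstantRankFibres L i)
    (hred : ∀ x : Point s, AlgebraicGeometry.IsReduced (schemeFibre (i ≫ π) x)) :
    IsSubbundle L i := by
  obtain ⟨hi, d, hd⟩ := hF
  choose W hW hd using hd
  have := hi.isClosedImmersion
  have := hi.isReduced
  have := hX.isReduced
  have := hX.locallyOfFiniteType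
  have := hE.isVariety.isSeparated
  have := hE.isVariety.locallyOfFiniteType
  have := hE.isVariety.quasiCompact
  have : Mono i := inferInstance
  refine ⟨hi, this, W, hW, d, ⟨hi.isReduced, ?_, ?_, ?_⟩, fun x => ?_, fun x => ?_, fun x => ?_⟩
  · rw [Category.assoc]
    infer_instance
  · rw [Category.assoc]
    infer_instance
  · rw [Category.assoc]
    infer_instance
  · have := hE.finite x
    exact Module.Finite.equiv (inducedFibreEquiv L i W hW x).symm
  · exact (inducedFibreEquiv L i W hW x).finrank_eq.trans (hd x)
  · have : JacobsonSpace X := LocallyOfFiniteType.jacobsonSpace s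
    -- `x` need not be closed: it specializes to a closed point `z`, and every open neighbourhood of
    -- `z` contains `x`.
    obtain ⟨z, hxz, hz : IsClosed {z}⟩ := nonempty_inter_closedPoints
      (Set.singleton_nonempty x).closure isClosed_closure.isLocallyClosed
    obtain ⟨a⟩ : Nonempty ↥(Spec (.of k)) := inferInstance
    let y : Point s := ⟨pointOfClosedPoint s z hz, pointOfClosedPoint_comp s z hz⟩
    have hya : y.1 a = z := pointOfClosedPoint_apply s z hz a
    obtain ⟨U, hU, φ, hφ⟩ := hE.locallyTrivial z
    obtain ⟨V, hV, ψ, hψ⟩ := hφ.exists_induced i W hW d hd y a (by rwa [hya]) (hred y)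
    rw [hya] at hV
    exact ⟨V, (specializes_iff_mem_closure.2 hxz).mem_open V.2 hV, ψ, hψ⟩

end VarietyBundle

theorem proposition2 {k : Type u} [Field k] [IsAlgClosed k] {X E F : Scheme.{u}}
    (s : X ⟶ Spec (.of k)) (hX : VarietyBundle.IsVariety s) (hconn : ConnectedSpace X)
    (π : E ⟶ X) (L : VarietyBundle.LinearFibres s π) (n : ℕ)
    (hE : VarietyBundle.IsVectorBundle L n)
    (i : F ⟶ E) (hF : VarietyBundle.HasConstantRankFibres L i) :
    (VarietyBundle.IsSubbundle L i ↔
      ∀ x : VarietyBundle.Point s, AlgebraicGeometry.IsReduced (VarietyBundle.schemeInter π i x)) ∧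
    (VarietyBundle.IsSubbundle L i ↔
      ∀ x : VarietyBundle.Point s, AlgebraicGeometry.IsReduced (VarietyBundle.schemeFibre (i ≫ π) x)) ∧
    (∀ x : VarietyBundle.Point s,
      ∃ e : VarietyBundle.schemeInter π i x ≅ VarietyBundle.schemeFibre (i ≫ π) x,
        e.hom ≫ pullback.fst (i ≫ π) x.1 = pullback.fst i (pullback.fst π x.1)) := by
  have hiff : VarietyBundle.IsSubbundle L i ↔ ∀ x : VarietyBundle.Point s,
      AlgebraicGeometry.IsReduced (VarietyBundle.schemeFibre (i ≫ π) x) :=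
    ⟨fun ⟨_, _, _, _, _, hm⟩ x => hm.isReduced_schemeFibre x,
      VarietyBundle.isSubbundle_of_isReduced_schemeFibre hX hE hF⟩
  refine ⟨hiff.trans (forall_congr' fun x => ?_), hiff, fun x =>
    ⟨pullbackRightPullbackFstIso π x.1 i, pullbackRightPullbackFstIso_hom_fst π x.1 i⟩⟩
  exact ⟨fun _ => isReduced_of_isOpenImmersion (pullbackRightPullbackFstIso π x.1 i).hom,
    fun _ => isReduced_of_isOpenImmersion (pullbackRightPullbackFstIso π x.1 i).inv⟩
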